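/- Let $k$ be an algebraically closed field of characteristic zero and $B=k[x,y]$. Let $D$ be a locally nilpotent $k$-derivation of $B$ (every $b\in B$ satisfies $D^n(b)=0$ for some $n\ge 1$) which is nice, i.e. $D^2(x)=D^2(y)=0$, and let $s\in B$ be a slice of $D$, i.e. $D(s)=1$. Then there are a $k$-algebra automorphism $\phi$ of $B$ and a polynomial $p\in k[x]$ with $$\phi\, D\,\phi^{-1}=\frac{\partial}{\partial y}\qquad\text{and}\qquad \phi(s)=y+p(x).$$ Moreover, for every integer $N\neq 0$, the associated $\mathbb{G}_{\mathrm m}$-action on $\mathbb{A}^2=\operatorname{Spec}(B)$, $$\alpha_t(b)=\exp(-\lambda D)(b)\big|_{\lambda=(1-t^N)s}=\sum_{j\ge 0}\frac{(t^N-1)^j s^j}{j!}\,D^j(b)\qquad(b\in B),$$ whose infinitesimal generator is $NsD$, is linearizable: some automorphism $\psi$ of $B$ conjugates it to a diagonal linear action, i.e. there are integers $m_1,m_2$ such that $\psi\alpha_t\psi^{-1}(x)=t^{m_1}x$ and $\psi\alpha_t\psi^{-1}(y)=t^{m_2}y$. -/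

import Mathlib

open scoped TensorProduct LaurentPolynomial

namespace SliceAction

/-! ### Locally nilpotent derivations, and nice ones on polynomial rings -/

section Derivations

/-- `D` is locally nilpotent: every element is killed by some power `D ^ n`, `n ≥ 1`. -/
def IsLocallyNilpotent {k B : Type*} [CommRing k] [CommRing B] [Algebra k B]
    (D : Derivation k B B) : Prop :=
  ∀ b : B, ∃ n : ℕ, 1 ≤ n ∧ D^[n] b = 0

/-- A derivation of a polynomial ring is nice if `D ^ 2` kills every variable. -/
def IsNice {k σ : Type*} [CommRing k]
    (D : Derivation k (MvPolynomial σ k) (MvPolynomial σ k)) : Prop :=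
  ∀ i : σ, D (D (MvPolynomial.X i)) = 0

/-- A slice of `D`. -/
def IsSlice {k B : Type*} [CommRing k] [CommRing B] [Algebra k B]
    (D : Derivation k B B) (s : B) : Prop :=
  D s = 1

end Derivations

/-! ### The exponential of a locally nilpotent derivation -/

section Exponential

variable {k B : Type*} [Field k] [CommRing B] [Algebra k B] (D : Derivation k B B)

/-- The divided power `D ^ j / j!`, the `j`-th coefficient of `exp (λ D)`. -/
noncomputable def divPow (j : ℕ) (b : B) : B := ((j.factorial : k)⁻¹) • D^[j] b

theorem iterate_zero_right (j : ℕ) : D^[j] 0 = 0 := by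
  induction j with
  | zero => rfl
  | succ j ih => rw [Function.iterate_succ_apply', ih, map_zero]

theorem iterate_add_right (j : ℕ) (a b : B) : D^[j] (a + b) = D^[j] a + D^[j] b := by
  induction j with
  | zero => rfl
  | succ j ih => simp only [Function.iterate_succ_apply', ih, map_add]

theorem iterate_smul_right (j : ℕ) (c : k) (b : B) : D^[j] (c • b) = c • D^[j] b := by
  induction j with
  | zero => rfl
  | succ j ih => simp only [Function.iterate_succ_apply', ih, Derivation.map_smul]

theorem iterate_eq_zero_of_le {m n : ℕ} (h : m ≤ n) {b : B} (hb : D^[m] b = 0) :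
    D^[n] b = 0 := by
  obtain ⟨c, rfl⟩ := Nat.exists_eq_add_of_le' h
  rw [Function.iterate_add_apply, hb, iterate_zero_right]

theorem divPow_zero (b : B) : divPow D 0 b = b := by simp [divPow]

theorem divPow_succ [CharZero k] (j : ℕ) (b : B) :
    ((j + 1 : ℕ) : k) • divPow D (j + 1) b = D (divPow D j b) := by
  have h1 : ((j + 1 : ℕ) : k) ≠ 0 := Nat.cast_ne_zero.2 (Nat.succ_ne_zero j)
  rw [divPow, divPow, Derivation.map_smul, smul_smul, Function.iterate_succ_apply',
    Nat.factorial_succ, Nat.cast_mul, mul_inv, mul_inv_cancel_left₀ h1]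

theorem divPow_mul [CharZero k] (n : ℕ) (a b : B) :
    divPow D n (a * b) =
      ∑ p ∈ Finset.HasAntidiagonal.antidiagonal n, divPow D p.1 a * divPow D p.2 b := by
  induction n with
  | zero => simp [divPow_zero]
  | succ n ih =>
    have h1 : ((n + 1 : ℕ) : k) ≠ 0 := Nat.cast_ne_zero.2 (Nat.succ_ne_zero n)
    refine smul_right_injective B h1 ?_
    simp only
    rw [divPow_succ, ih, map_sum]
    have key : ∀ p ∈ Finset.HasAntidiagonal.antidiagonal (n + 1),
        ((n + 1 : ℕ) : k) • (divPow D p.1 a * divPow D p.2 b) =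
          ((p.1 : k) • divPow D p.1 a) * divPow D p.2 b
          + divPow D p.1 a * ((p.2 : k) • divPow D p.2 b) := by
      intro p hp
      rw [← Finset.HasAntidiagonal.mem_antidiagonal.1 hp, Nat.cast_add, add_smul, smul_mul_assoc,
        mul_smul_comm]
    rw [Finset.smul_sum, Finset.sum_congr rfl key, Finset.sum_add_distrib,
      Finset.Nat.sum_antidiagonal_succ, Finset.Nat.sum_antidiagonal_succ']
    simp only [divPow_succ, Nat.cast_zero, zero_smul, zero_mul, mul_zero, zero_add]
    rw [← Finset.sum_add_distrib]
    refine Finset.sum_congr rfl fun p _ => ?_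
    rw [Derivation.leibniz, smul_eq_mul, smul_eq_mul]
    ring

theorem divPow_divPow [CharZero k] (i j : ℕ) (b : B) :
    divPow D i (divPow D j b) = ((i + j).choose j : k) • divPow D (i + j) b := by
  simp only [divPow, iterate_smul_right, smul_smul, ← Function.iterate_add_apply]
  congr 1
  have hi : (i.factorial : k) ≠ 0 := Nat.cast_ne_zero.2 i.factorial_ne_zero
  have hj : (j.factorial : k) ≠ 0 := Nat.cast_ne_zero.2 j.factorial_ne_zero
  have hij : ((i + j).factorial : k) ≠ 0 := Nat.cast_ne_zero.2 (i + j).factorial_ne_zero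
  have h := Nat.add_choose_mul_factorial_mul_factorial i j
  have h' : ((i + j).choose j : k) * i.factorial * j.factorial = (i + j).factorial := by
    rw [← h]; push_cast; ring
  field_simp
  linear_combination -h'

variable {D}

/-- The polynomial `exp (λ D) b = ∑ j, (λ ^ j / j!) D ^ j b` in the indeterminate `λ`. -/
noncomputable def expPoly (hD : IsLocallyNilpotent D) (b : B) : Polynomial B :=
  ∑ j ∈ Finset.range (Classical.choose (hD b)), Polynomial.monomial j (divPow D j b)

theorem expPoly_coeff (hD : IsLocallyNilpotent D) (b : B) (j : ℕ) :
    (expPoly hD b).coeff j = divPow D j b := by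
  simp only [expPoly, Polynomial.finsetSum_coeff, Polynomial.coeff_monomial,
    Finset.sum_ite_eq', Finset.mem_range]
  split_ifs with h
  · rfl
  · rw [divPow, iterate_eq_zero_of_le D (not_lt.1 h) (Classical.choose_spec (hD b)).2, smul_zero]

variable [CharZero k]

/-- `b ↦ exp (λ D) b`, as a homomorphism of `k`-algebras `B → B[λ]`. -/
noncomputable def expHom (hD : IsLocallyNilpotent D) : B →ₐ[k] Polynomial B where
  toFun := expPoly hD
  map_one' := by
    ext j
    rw [expPoly_coeff, Polynomial.coeff_one]
    cases j with
    | zero => simp [divPow]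
    | succ j =>
      simp [divPow, Function.iterate_succ_apply]
  map_zero' := by
    ext j
    rw [expPoly_coeff, Polynomial.coeff_zero, divPow, iterate_zero_right, smul_zero]
  map_mul' a b := by
    ext j
    simp only [Polynomial.coeff_mul, expPoly_coeff, divPow_mul]
  map_add' a b := by
    ext j
    simp only [Polynomial.coeff_add, expPoly_coeff, divPow, iterate_add_right, smul_add]
  commutes' c := by
    ext j
    rw [expPoly_coeff, Polynomial.algebraMap_apply, Polynomial.coeff_C]
    cases j with
    | zero => simp [divPow]
    | succ j =>
      simp [divPow, Function.iterate_succ_apply]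

theorem expHom_coeff (hD : IsLocallyNilpotent D) (b : B) (j : ℕ) :
    (expHom hD b).coeff j = divPow D j b := expPoly_coeff hD b j

theorem expHom_slice (hD : IsLocallyNilpotent D) {s : B} (hs : IsSlice D s) :
    expHom hD s = Polynomial.C s + Polynomial.X := by
  ext j
  rw [expHom_coeff, Polynomial.coeff_add, Polynomial.coeff_C, Polynomial.coeff_X]
  have hs' : D s = 1 := hs
  match j with
  | 0 => simp [divPow]
  | 1 => simp [divPow, hs']
  | j + 2 => simp [divPow, Function.iterate_succ_apply, hs']

theorem expHom_divPow (hD : IsLocallyNilpotent D) (b : B) (j : ℕ) :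
    expHom hD (divPow D j b) = Polynomial.hasseDeriv j (expHom hD b) := by
  ext i
  rw [expHom_coeff, Polynomial.hasseDeriv_coeff, expHom_coeff, divPow_divPow,
    ← nsmul_eq_mul, Nat.cast_smul_eq_nsmul]

/-- `exp (μ D)` after `exp (ν D)` is `exp ((ν + μ) D)`, in any `B`-algebra. -/
theorem eval₂_expHom_add (hD : IsLocallyNilpotent D) {C : Type*} [CommRing C]
    (f g : B →+* C) (ν μ : C) (hg : ∀ b, g b = (expHom hD b).eval₂ f ν) (b : B) :
    (expHom hD b).eval₂ g μ = (expHom hD b).eval₂ f (ν + μ) := by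
  have h1 : (expHom hD b).map g = Polynomial.taylor ν ((expHom hD b).map f) := by
    ext j
    rw [Polynomial.coeff_map, Polynomial.taylor_coeff, expHom_coeff, hg, expHom_divPow,
      Polynomial.eval₂_eq_eval_map]
    congr 1
    ext i
    simp [Polynomial.hasseDeriv_coeff]
  rw [Polynomial.eval₂_eq_eval_map, h1, Polynomial.taylor_eval, Polynomial.eval₂_eq_eval_map,
    add_comm]

end Exponential

/-! ### Regular actions of the multiplicative group on an affine scheme -/

section Actions

/-- A regular action of `𝔾ₘ = Spec k[T;T⁻¹]` on `Spec B`, given by its coaction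
`α : B → B ⊗ k[T;T⁻¹]` (that is, `B → B[T;T⁻¹]`, where `T` is the parameter `t` in `α_t`). -/
structure GmAction (k B : Type*) [Field k] [CommRing B] [Algebra k B] where
  coaction : B →ₐ[k] B ⊗[k] k[T;T⁻¹]
  coassoc : ∀ b : B,
    Algebra.TensorProduct.assoc k k k B k[T;T⁻¹] k[T;T⁻¹]
        (Algebra.TensorProduct.map coaction (AlgHom.id k k[T;T⁻¹]) (coaction b)) =
      Algebra.TensorProduct.map (AlgHom.id k B) (Bialgebra.comulAlgHom k k[T;T⁻¹]) (coaction b)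
  counit : ∀ b : B,
    Algebra.TensorProduct.rid k k B
        (Algebra.TensorProduct.map (AlgHom.id k B) (Bialgebra.counitAlgHom k k[T;T⁻¹])
          (coaction b)) = b

/-- A `𝔾ₘ`-action on affine space `Spec k[x_i : i ∈ σ]` is linearizable if some automorphism `φ`
of the polynomial ring conjugates it to a diagonal linear action `x_i ↦ t ^ (m i) x_i`.
(Linear actions of `𝔾ₘ` are diagonalizable by a linear change of coordinates.) -/
def GmAction.IsLinearizable {k σ : Type*} [Field k] (α : GmAction k (MvPolynomial σ k)) : Prop :=
  ∃ (φ : MvPolynomial σ k ≃ₐ[k] MvPolynomial σ k) (m : σ → ℤ), ∀ i : σ,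
    Algebra.TensorProduct.map (φ : MvPolynomial σ k →ₐ[k] MvPolynomial σ k)
        (AlgHom.id k k[T;T⁻¹]) (α.coaction (φ.symm (MvPolynomial.X i))) =
      MvPolynomial.X i ⊗ₜ[k] LaurentPolynomial.T (m i)

variable {k B : Type*} [Field k] [CharZero k] [CommRing B] [Algebra k B] {D : Derivation k B B}

/-- The map `α_t = exp (-λ D)` evaluated at `λ = (1 - t ^ N) s`. -/
noncomputable def sliceCoaction (hD : IsLocallyNilpotent D) (s : B) (N : ℤ) :
    B →ₐ[k] B ⊗[k] k[T;T⁻¹] :=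
  (Polynomial.eval₂AlgHom
    (Algebra.TensorProduct.includeLeft : B →ₐ[k] B ⊗[k] k[T;T⁻¹])
    (-(s ⊗ₜ[k] (1 - LaurentPolynomial.T N))) (fun _ => Commute.all _ _)).comp (expHom hD)

theorem sliceCoaction_apply (hD : IsLocallyNilpotent D) (s : B) (N : ℤ) (b : B) :
    sliceCoaction hD s N b =
      (expHom hD b).eval₂
        (Algebra.TensorProduct.includeLeft : B →ₐ[k] B ⊗[k] k[T;T⁻¹]).toRingHom
        (-(s ⊗ₜ[k] (1 - LaurentPolynomial.T N))) := rfl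

theorem sliceCoaction_slice (hD : IsLocallyNilpotent D) {s : B} (hs : IsSlice D s) (N : ℤ) :
    sliceCoaction hD s N s = s ⊗ₜ[k] LaurentPolynomial.T N := by
  rw [sliceCoaction_apply, expHom_slice hD hs]
  simp [TensorProduct.tmul_sub]

/-- The `𝔾ₘ`-action on `Spec B` associated with a locally nilpotent derivation `D` with slice `s`
and an integer `N`: the action `α_t = exp (-λ D)` at `λ = (1 - t ^ N) s`, whose infinitesimal
generator is `N s D`. -/
noncomputable def associatedAction (hD : IsLocallyNilpotent D) {s : B} (hs : IsSlice D s)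
    (N : ℤ) : GmAction k B where
  coaction := sliceCoaction hD s N
  coassoc b := by
    set L : B ⊗[k] k[T;T⁻¹] →ₐ[k] B ⊗[k] (k[T;T⁻¹] ⊗[k] k[T;T⁻¹]) :=
      (Algebra.TensorProduct.assoc k k k B k[T;T⁻¹] k[T;T⁻¹]).toAlgHom.comp
        (Algebra.TensorProduct.map (sliceCoaction hD s N) (AlgHom.id k k[T;T⁻¹])) with hL
    set J : B ⊗[k] k[T;T⁻¹] →ₐ[k] B ⊗[k] (k[T;T⁻¹] ⊗[k] k[T;T⁻¹]) :=
      (Algebra.TensorProduct.assoc k k k B k[T;T⁻¹] k[T;T⁻¹]).toAlgHom.comp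
        Algebra.TensorProduct.includeLeft with hJ
    set R : B ⊗[k] k[T;T⁻¹] →ₐ[k] B ⊗[k] (k[T;T⁻¹] ⊗[k] k[T;T⁻¹]) :=
      Algebra.TensorProduct.map (AlgHom.id k B) (Bialgebra.comulAlgHom k k[T;T⁻¹]) with hR
    set ι : B →ₐ[k] B ⊗[k] k[T;T⁻¹] := Algebra.TensorProduct.includeLeft with hι
    set l : B ⊗[k] k[T;T⁻¹] := -(s ⊗ₜ[k] (1 - LaurentPolynomial.T N)) with hl
    change L (sliceCoaction hD s N b) = R (sliceCoaction hD s N b)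
    have hLι : ∀ c, (L.toRingHom.comp ι.toRingHom) c =
        (expHom hD c).eval₂ (J.toRingHom.comp ι.toRingHom) (J l) := by
      intro c
      have : L (ι c) = J (sliceCoaction hD s N c) := by
        simp [hL, hJ, hι]
      change L (ι c) = _
      rw [this, sliceCoaction_apply]
      exact Polynomial.hom_eval₂ _ _ J.toRingHom _
    have hRι : R.toRingHom.comp ι.toRingHom = J.toRingHom.comp ι.toRingHom := by
      ext c
      simp [hR, hJ, hι, Algebra.TensorProduct.one_def]
    have e1 : L (sliceCoaction hD s N b) =
        (expHom hD b).eval₂ (L.toRingHom.comp ι.toRingHom) (L l) := by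
      rw [sliceCoaction_apply]
      exact Polynomial.hom_eval₂ _ _ L.toRingHom _
    have e2 : R (sliceCoaction hD s N b) =
        (expHom hD b).eval₂ (R.toRingHom.comp ι.toRingHom) (R l) := by
      rw [sliceCoaction_apply]
      exact Polynomial.hom_eval₂ _ _ R.toRingHom _
    rw [e1, e2, hRι]
    refine (eval₂_expHom_add hD (C := B ⊗[k] (k[T;T⁻¹] ⊗[k] k[T;T⁻¹]))
      (J.toRingHom.comp ι.toRingHom) (L.toRingHom.comp ι.toRingHom) (J l) (L l) hLι b).trans ?_
    congr 1
    simp only [hL, hJ, hR, hl, map_neg, TensorProduct.tmul_sub, map_sub, AlgHom.comp_apply,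
      Algebra.TensorProduct.map_tmul, sliceCoaction_slice hD hs, AlgHom.id_apply,
      Bialgebra.comulAlgHom_apply, LaurentPolynomial.comul_T,
      Algebra.TensorProduct.includeLeft_apply,
      Bialgebra.comul_one, Algebra.TensorProduct.one_def]
    abel
  counit b := by
    set E : B ⊗[k] k[T;T⁻¹] →ₐ[k] B :=
      (Algebra.TensorProduct.rid k k B).toAlgHom.comp
        (Algebra.TensorProduct.map (AlgHom.id k B) (Bialgebra.counitAlgHom k k[T;T⁻¹])) with hE
    change E (sliceCoaction hD s N b) = b
    have e1 : E (sliceCoaction hD s N b) =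
        (expHom hD b).eval₂ (E.toRingHom.comp
          (Algebra.TensorProduct.includeLeft : B →ₐ[k] B ⊗[k] k[T;T⁻¹]).toRingHom)
          (E (-(s ⊗ₜ[k] (1 - LaurentPolynomial.T N)))) := by
      rw [sliceCoaction_apply]
      exact Polynomial.hom_eval₂ _ _ E.toRingHom _
    have e2 : E (-(s ⊗ₜ[k] (1 - LaurentPolynomial.T N))) = 0 := by
      simp [hE, TensorProduct.tmul_sub]
    rw [e1, e2, Polynomial.eval₂_at_zero, expHom_coeff, divPow_zero]
    simp [hE]

end Actions

end SliceAction

/-! ### Partial derivatives, derivations and coordinate changes -/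

namespace MvPolynomial

/-! Write `D = u ∂/∂x + v ∂/∂y`. The slice equation `u s_x + v s_y = 1` makes `u` and `v` coprime,
while `D²x = 0` reads `u u_x + v u_y = 0`. Hence `u` divides `u_y`, which has smaller degree in `y`
unless it vanishes; so `u_y = 0`, then `u u_x = 0`, and `u` is constant. By symmetry `v` is constant
(`IsNice.exists_eq_C`). A nonzero constant vector field is `∂/∂y` in linear coordinates, where `s -
y` has zero `y`-derivative and is thus a polynomial in `x`. For the action, `ker D` is fixed and
`exp(λD)s = s + λ` becomes `t^N s` at `λ = -(1 - t^N)s`. The slice and the coordinate killed by `D`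
together generate `k[x,y]`, so they diagonalize the action. -/

theorem degreeOf_pderiv_lt {R σ : Type*} [CommSemiring R] {i : σ} {f : MvPolynomial σ R}
    (h : pderiv i f ≠ 0) : degreeOf i (pderiv i f) < degreeOf i f := by
  classical
  obtain ⟨m, hm, hd⟩ := Finset.exists_mem_eq_sup (pderiv i f).support
    (support_nonempty.2 h) (fun m => m i)
  rw [degreeOf_eq_sup, hd, degreeOf_eq_sup]
  have h1 : m + Finsupp.single i 1 ∈ f.support := by
    rw [mem_support_iff, coeff_pderiv] at hm
    exact mem_support_iff.2 (left_ne_zero_of_mul hm)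
  have h2 := monomial_le_degreeOf i h1
  rw [Finsupp.add_apply, Finsupp.single_eq_same, degreeOf_eq_sup] at h2
  exact h2

theorem pderiv_eq_zero_of_dvd {R σ : Type*} [CommRing R] [IsDomain R] {i : σ}
    {f : MvPolynomial σ R} (h : f ∣ pderiv i f) : pderiv i f = 0 := by
  by_contra h0
  have h1 := degreeOf_pderiv_lt h0
  obtain ⟨g, hg⟩ := h
  have hf : f ≠ 0 := by rintro rfl; simp at h0
  have hg0 : g ≠ 0 := by rintro rfl; simp [hg] at h0
  rw [hg, degreeOf_mul_eq hf hg0] at h1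
  omega

theorem eq_zero_of_mem_support_of_pderiv_eq_zero {R σ : Type*} [CommRing R] [IsDomain R]
    [CharZero R] {i : σ} {f : MvPolynomial σ R} (h : pderiv i f = 0) {m : σ →₀ ℕ}
    (hm : m ∈ f.support) : m i = 0 := by
  classical
  by_contra h0
  -- Up to the nonzero factor `m i`, this coefficient of the derivative is `coeff m f`; `m i ≠ 0`
  -- keeps the subtraction from truncating.
  have h1 := coeff_pderiv (i := i) f (m - Finsupp.single i 1)
  have h2 : m - Finsupp.single i 1 + Finsupp.single i 1 = m :=
    Finsupp.sub_add_single_one_cancel h0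
  rw [h, h2, coeff_zero, eq_comm, mul_eq_zero] at h1
  rcases h1 with h1 | h1
  · exact mem_support_iff.1 hm h1
  · exact Nat.cast_add_one_ne_zero _ h1

theorem eq_C_of_forall_pderiv_eq_zero {R σ : Type*} [CommRing R] [IsDomain R] [CharZero R]
    {f : MvPolynomial σ R} (h : ∀ i, pderiv i f = 0) : f = C (coeff 0 f) := by
  classical
  ext m
  rw [coeff_C]
  split_ifs with hm
  · rw [hm]
  · by_contra h0
    exact hm (Finsupp.ext fun i =>
      eq_zero_of_mem_support_of_pderiv_eq_zero (h i) (mem_support_iff.2 h0)).symm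

theorem exists_aeval_X_zero_of_pderiv_one_eq_zero {R : Type*} [CommRing R] [IsDomain R]
    [CharZero R] {f : MvPolynomial (Fin 2) R} (h : pderiv 1 f = 0) :
    ∃ p : Polynomial R, f = Polynomial.aeval (X 0) p := by
  -- No exponent in the support involves `y`, so `m 0` determines the monomial.
  refine ⟨∑ m ∈ f.support, Polynomial.monomial (m 0) (coeff m f), ?_⟩
  rw [map_sum]
  conv_lhs => rw [f.as_sum]
  refine Finset.sum_congr rfl fun m hm => ?_
  rw [Polynomial.aeval_monomial, monomial_eq, algebraMap_eq,
    Finsupp.prod_fintype _ _ fun i => pow_zero _, Fin.prod_univ_two,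
    eq_zero_of_mem_support_of_pderiv_eq_zero h hm, pow_zero, mul_one]

theorem derivation_apply_eq_add {R : Type*} [CommRing R]
    (D : Derivation R (MvPolynomial (Fin 2) R) (MvPolynomial (Fin 2) R))
    (f : MvPolynomial (Fin 2) R) :
    D f = D (X 0) * pderiv 0 f + D (X 1) * pderiv 1 f := by
  have : D = D (X 0) • pderiv 0 + D (X 1) • pderiv 1 := by
    refine derivation_ext fun i => ?_
    fin_cases i <;> simp
  exact congrArg (fun E => E f) this

/-- Both sides obey the Leibniz rule along `φ`, so the variables decide. -/
theorem algHom_derivation_comm {R σ B : Type*} [CommRing R] [CommRing B] [Algebra R B]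
    (φ : MvPolynomial σ R →ₐ[R] B)
    (D : Derivation R (MvPolynomial σ R) (MvPolynomial σ R)) (E : Derivation R B B)
    (h : ∀ i, φ (D (X i)) = E (φ (X i))) (f : MvPolynomial σ R) : φ (D f) = E (φ f) := by
  induction f using MvPolynomial.induction_on with
  | C a =>
    rw [derivation_C, map_zero, ← algebraMap_eq, AlgHom.commutes, Derivation.map_algebraMap]
  | add p q hp hq => simp only [map_add, hp, hq]
  | mul_X p i hp => simp only [Derivation.leibniz, map_add, map_mul, smul_eq_mul, hp, h]

/-- The triangular automorphism `x ↦ x`, `y ↦ y - p(x)`. -/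
noncomputable def shearEquiv {R : Type*} [CommRing R] (p : Polynomial R) :
    MvPolynomial (Fin 2) R ≃ₐ[R] MvPolynomial (Fin 2) R :=
  AlgEquiv.ofAlgHom
    (aeval ![X 0, X 1 - Polynomial.aeval (X 0) p])
    (aeval ![X 0, X 1 + Polynomial.aeval (X 0) p])
    (by ext i : 1; fin_cases i <;> simp [← Polynomial.aeval_algHom_apply])
    (by ext i : 1; fin_cases i <;> simp [← Polynomial.aeval_algHom_apply])

theorem shearEquiv_symm_X_zero {R : Type*} [CommRing R] (p : Polynomial R) :
    (shearEquiv p).symm (X 0) = X 0 := by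
  simp [shearEquiv]

theorem shearEquiv_symm_X_one {R : Type*} [CommRing R] (p : Polynomial R) :
    (shearEquiv p).symm (X 1) = X 1 + Polynomial.aeval (X 0) p := by
  simp [shearEquiv]

/-- A nonzero constant vector field on the plane becomes `∂/∂y` in suitable linear coordinates. -/
theorem exists_algEquiv_X_eq_pderiv_one {k : Type*} [Field k] {a b : k} (h : a ≠ 0 ∨ b ≠ 0) :
    ∃ φ : MvPolynomial (Fin 2) k ≃ₐ[k] MvPolynomial (Fin 2) k,
      pderiv 1 (φ (X 0)) = C a ∧ pderiv 1 (φ (X 1)) = C b := by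
  by_cases ha : a = 0
  · have hb : b ≠ 0 := by tauto
    have h1 : (C b : MvPolynomial (Fin 2) k) * C b⁻¹ = 1 := by rw [← C_mul]; simp [hb]
    refine ⟨AlgEquiv.ofAlgHom (aeval ![X 0, C b * X 1]) (aeval ![X 0, C b⁻¹ * X 1]) ?_ ?_,
      ?_, ?_⟩
    · ext i : 1
      fin_cases i
      · simp
      · simp [algebraMap_eq]; linear_combination X 1 * h1
    · ext i : 1
      fin_cases i
      · simp
      · simp [algebraMap_eq]; linear_combination X 1 * h1
    · simp [ha]
    · simp
  -- The variables swap roles, so that only `a` needs inverting.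
  · have h1 : (C a : MvPolynomial (Fin 2) k) * C a⁻¹ = 1 := by rw [← C_mul]; simp [ha]
    refine ⟨AlgEquiv.ofAlgHom (aeval ![C a * X 1, X 0 + C b * X 1])
      (aeval ![X 1 - C b * C a⁻¹ * X 0, C a⁻¹ * X 0]) ?_ ?_, ?_, ?_⟩
    · ext i : 1
      fin_cases i
      · simp [algebraMap_eq]; linear_combination (-C b * X 1) * h1
      · simp [algebraMap_eq]; linear_combination X 1 * h1
    · ext i : 1
      fin_cases i
      · simp [algebraMap_eq]; linear_combination X 0 * h1
      · simp [algebraMap_eq]; ring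
    · simp
    · simp

end MvPolynomial

/-! ### Normal form of a nice derivation and linearization -/

namespace SliceAction

open MvPolynomial

/-- A nice derivation of `k[x, y]` with a slice has constant coefficients, not both zero. -/
theorem IsNice.exists_eq_C {k : Type*} [Field k] [CharZero k]
    {D : Derivation k (MvPolynomial (Fin 2) k) (MvPolynomial (Fin 2) k)}
    (hnice : IsNice D) {s : MvPolynomial (Fin 2) k} (hs : IsSlice D s) :
    ∃ a b : k, (a ≠ 0 ∨ b ≠ 0) ∧ D (X 0) = C a ∧ D (X 1) = C b := by
  have h0 := hnice 0
  have h1 := hnice 1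
  have hs' : D s = 1 := hs
  rw [derivation_apply_eq_add] at h0 h1 hs'
  generalize D (X 0) = u at *
  generalize D (X 1) = v at *
  have huv : IsCoprime u v := ⟨pderiv 0 s, pderiv 1 s, by linear_combination hs'⟩
  have hu : pderiv 1 u = 0 := pderiv_eq_zero_of_dvd
    (huv.dvd_of_dvd_mul_left ⟨-pderiv 0 u, by linear_combination h0⟩)
  have hv : pderiv 0 v = 0 := pderiv_eq_zero_of_dvd
    (huv.symm.dvd_of_dvd_mul_left ⟨-pderiv 1 v, by linear_combination h1⟩)
  -- What remains of `D²x = 0` is `u u_x = 0` in a domain.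
  have hu' : pderiv 0 u = 0 := by
    rw [hu, mul_zero, add_zero, mul_eq_zero] at h0
    rcases h0 with rfl | h0
    · exact map_zero _
    · exact h0
  have hv' : pderiv 1 v = 0 := by
    rw [hv, mul_zero, zero_add, mul_eq_zero] at h1
    rcases h1 with rfl | h1
    · exact map_zero _
    · exact h1
  have eu := eq_C_of_forall_pderiv_eq_zero (f := u) (Fin.forall_fin_two.2 ⟨hu', hu⟩)
  have ev := eq_C_of_forall_pderiv_eq_zero (f := v) (Fin.forall_fin_two.2 ⟨hv, hv'⟩)
  refine ⟨_, _, ?_, eu, ev⟩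
  by_contra! h
  rw [eu, ev, h.1, h.2] at hs'
  simp at hs'

theorem IsNice.exists_algEquiv {k : Type*} [Field k] [CharZero k]
    {D : Derivation k (MvPolynomial (Fin 2) k) (MvPolynomial (Fin 2) k)}
    (hnice : IsNice D) {s : MvPolynomial (Fin 2) k} (hs : IsSlice D s) :
    ∃ (φ : MvPolynomial (Fin 2) k ≃ₐ[k] MvPolynomial (Fin 2) k) (p : Polynomial k),
      (∀ f : MvPolynomial (Fin 2) k, φ (D (φ.symm f)) = pderiv 1 f) ∧
        φ s = X 1 + Polynomial.aeval (X 0) p := by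
  obtain ⟨a, b, hab, ha, hb⟩ := hnice.exists_eq_C hs
  obtain ⟨φ, hφ0, hφ1⟩ := exists_algEquiv_X_eq_pderiv_one hab
  have hφ : ∀ f, φ (D f) = pderiv 1 (φ f) := by
    refine algHom_derivation_comm φ.toAlgHom D (pderiv 1) (Fin.forall_fin_two.2 ⟨?_, ?_⟩)
    · change φ (D (X 0)) = pderiv 1 (φ (X 0))
      rw [ha, hφ0]
      exact φ.commutes a
    · change φ (D (X 1)) = pderiv 1 (φ (X 1))
      rw [hb, hφ1]
      exact φ.commutes b
  have hs' : D s = 1 := hs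
  obtain ⟨p, hp⟩ := exists_aeval_X_zero_of_pderiv_one_eq_zero (f := φ s - X 1)
    (by rw [map_sub, ← hφ, hs', map_one, pderiv_X_self, sub_self])
  exact ⟨φ, p, fun f => by rw [hφ, φ.apply_symm_apply], by rw [← hp]; ring⟩

/-- On `ker D` the exponential series stops at its constant term. -/
theorem sliceCoaction_eq_of_apply_eq_zero {k B : Type*} [Field k] [CharZero k] [CommRing B]
    [Algebra k B] {D : Derivation k B B} (hD : IsLocallyNilpotent D) (s : B) (N : ℤ) {b : B}
    (hb : D b = 0) : sliceCoaction hD s N b = b ⊗ₜ[k] 1 := by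
  have : expHom hD b = Polynomial.C b := by
    ext j
    rw [expHom_coeff, Polynomial.coeff_C]
    cases j with
    | zero => simp [divPow]
    | succ j => simp [divPow, Function.iterate_succ_apply, hb]
  rw [sliceCoaction_apply, this, Polynomial.eval₂_C]
  rfl

/-- If `D` and `s` become `∂/∂y` and `y + p(x)` in suitable coordinates, then the associated
action has weights `0` and `N` in the coordinates `x` and `y + p(x)`. -/
theorem associatedAction_isLinearizable {k : Type*} [Field k] [CharZero k]
    {D : Derivation k (MvPolynomial (Fin 2) k) (MvPolynomial (Fin 2) k)}
    (hD : IsLocallyNilpotent D) {s : MvPolynomial (Fin 2) k} (hs : IsSlice D s)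
    (φ : MvPolynomial (Fin 2) k ≃ₐ[k] MvPolynomial (Fin 2) k) (p : Polynomial k)
    (hφ : ∀ f : MvPolynomial (Fin 2) k, φ (D (φ.symm f)) = pderiv 1 f)
    (hφs : φ s = X 1 + Polynomial.aeval (X 0) p) (N : ℤ) :
    (associatedAction hD hs N).IsLinearizable := by
  have h0 : (φ.trans (shearEquiv p)).symm (X 0) = φ.symm (X 0) :=
    congrArg φ.symm (shearEquiv_symm_X_zero p)
  -- The shear absorbs `p`, so the slice itself is the second coordinate.
  have h1 : (φ.trans (shearEquiv p)).symm (X 1) = s := by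
    refine (congrArg φ.symm (shearEquiv_symm_X_one p)).trans ?_
    rw [← hφs, φ.symm_apply_apply]
  have hD0 : D ((φ.trans (shearEquiv p)).symm (X 0)) = 0 := by
    apply φ.injective
    rw [h0, hφ, map_zero, pderiv_X_of_ne (by decide)]
  refine ⟨φ.trans (shearEquiv p), ![0, N], Fin.forall_fin_two.2 ⟨?_, ?_⟩⟩
  · change Algebra.TensorProduct.map _ _ (sliceCoaction hD s N _) = _
    rw [sliceCoaction_eq_of_apply_eq_zero hD s N hD0, Algebra.TensorProduct.map_tmul,
      AlgEquiv.coe_toAlgHom, AlgEquiv.apply_symm_apply, map_one]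
    simp
  · change Algebra.TensorProduct.map _ _ (sliceCoaction hD s N _) = _
    rw [h1, sliceCoaction_slice hD hs, Algebra.TensorProduct.map_tmul, AlgEquiv.coe_toAlgHom,
      AlgHom.id_apply, ← h1, AlgEquiv.apply_symm_apply]
    simp

end SliceAction

theorem mainTheorem6 {k : Type*} [Field k] [IsAlgClosed k] [CharZero k]
    (D : Derivation k (MvPolynomial (Fin 2) k) (MvPolynomial (Fin 2) k))
    (hD : SliceAction.IsLocallyNilpotent D) (hnice : SliceAction.IsNice D)
    (s : MvPolynomial (Fin 2) k) (hs : SliceAction.IsSlice D s) :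
    (∃ (φ : MvPolynomial (Fin 2) k ≃ₐ[k] MvPolynomial (Fin 2) k) (p : Polynomial k),
      (∀ f : MvPolynomial (Fin 2) k, φ (D (φ.symm f)) = MvPolynomial.pderiv 1 f) ∧
        φ s = MvPolynomial.X 1 + Polynomial.aeval (MvPolynomial.X 0) p) ∧
    ∀ N : ℤ, N ≠ 0 → (SliceAction.associatedAction hD hs N).IsLinearizable := by
  obtain ⟨φ, p, hφ, hφs⟩ := hnice.exists_algEquiv hs
  exact ⟨⟨φ, p, hφ, hφs⟩, fun N _ =>
    SliceAction.associatedAction_isLinearizable hD hs φ p hφ hφs N⟩
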